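/- Consider an $N$-dimensional quantum system whose density matrix obeys the master equation $$\dot\rho(t)=\mathcal L(\mathbf u(t))\rho(t),\quad \rho(t_{\rm i})=\rho_0,\qquad \mathcal L(\mathbf u)=\mathcal L_0+\sum_{j=1}^{m}u_j\mathcal L_j ,$$ where $\rho_0$ is a given density matrix, the controls $u_j(t)$ are integrable functions of time with $u_{\min,j}\le u_j(t)\le u_{\max,j}$, and the $\mathcal L_j$ are linear superoperators such that, for all admissible values of $\mathbf u$, $\mathcal L(\mathbf u)$ generates a trace- and Hermiticity-preserving evolution. The terminal control problem is to maximize $J=\operatorname{Tr}[O\rho(T)]$, with $O$ a given Hermitian observable, at a fixed or free final time $T\ge t_{\rm i}$. Let $(\tilde{\mathbf u},T,\tilde\rho)$ be an optimal process with performance index $\tilde J$, and let $\tilde\psi$ be its costate, i.e. the solution on $[t_{\rm i},T]$ of $\dot\psi=-\partial K/\partial\rho$ with $\tilde\psi(T)=O-\tilde J\,\mathbb 1$, where $K(\rho,\mathbf u,\psi)=\operatorname{Tr}[\psi\,\mathcal L(\mathbf u)\rho]$. An interval $(t_1,t_2)$ with $t_{\rm i}\le t_1<t_2\le T$ is called a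 singular subarc of $\tilde u_k$ if the switching function $\partial K/\partial u_k=\operatorname{Tr}[\tilde\psi(t)\mathcal L_k\tilde\rho(t)]$ vanishes for all $t\in(t_1,t_2)$. **Theorem.** Suppose that for some $k$ there is a density matrix $\rho_k$ such that $\mathcal L_k\rho=-\rho+\rho_k$ for all density matrices $\rho$; the other $\mathcal L_j$ may be of any type. Then the optimal control $\tilde u_k$ has no singular subarcs, except for those on which it is unspecified and redundant. That is, if $(t_1,t_2)$ is a singular subarc of $\tilde u_k$, then every integrable variation of $\tilde u_k$ that vanishes outside $(t_1,t_2)$ (all other controls and $T$ being unchanged), whether or not it respects the bounds on $u_k$, leaves the performance index unchanged, $J=\tilde J$; in particular, every such variation that respects the bounds yields again an optimal control. -/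

import Mathlib

open MeasureTheory
open scoped ComplexOrder

/-- Operators on an `N`-dimensional Hilbert space. -/
abbrev Op (N : ℕ) : Type := Matrix (Fin N) (Fin N) ℂ

/-- Linear superoperators. -/
abbrev Superop (N : ℕ) : Type := Op N →ₗ[ℂ] Op N

/-- Density matrices: positive semidefinite with unit trace. -/
def IsDensityMatrix {N : ℕ} (ρ : Op N) : Prop :=
  ρ.PosSemidef ∧ ρ.trace = 1

/-- A superoperator which can stand on the right-hand side of a master equation: the flow it
generates preserves the trace and Hermiticity. (Complete positivity is not required.) -/
def IsLiouvillian {N : ℕ} (M : Superop N) : Prop :=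
  (∀ X : Op N, (M X).trace = 0) ∧
    ∀ X : Op N, M X.conjTranspose = (M X).conjTranspose

/-- The data of the terminal control problem with `m` independent linear controls, each with
its own interval of admissible values. -/
structure TerminalControlProblem (N m : ℕ) where
  /-- the uncontrolled part of the Liouvillian -/
  L₀ : Superop N
  /-- the controlled parts of the Liouvillian -/
  L : Fin m → Superop N
  /-- lower bounds of the controls -/
  umin : Fin m → ℝ
  /-- upper bounds of the controls -/
  umax : Fin m → ℝ
  /-- the observable -/
  O : Op N
  O_isHermitian : O.IsHermitian
  /-- the given initial state -/
  ρ₀ : Op N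
  ρ₀_isDensityMatrix : IsDensityMatrix ρ₀
  /-- the initial time -/
  ti : ℝ
  /-- `some t`: the final time is fixed and equal to `t`; `none`: the final time is free -/
  tf : Option ℝ
  /-- for all admissible values of the controls the total generator is a Liouvillian -/
  isLiouvillian : ∀ u : Fin m → ℝ, (∀ j, u j ∈ Set.Icc (umin j) (umax j)) →
    IsLiouvillian (L₀ + ∑ j, (u j : ℂ) • L j)

namespace TerminalControlProblem

variable {N m : ℕ} (P : TerminalControlProblem N m)

/-- The Liouvillian `L(u) = L₀ + ∑ⱼ uⱼ Lⱼ`. -/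
def liouvillian (u : Fin m → ℝ) : Superop N :=
  P.L₀ + ∑ j, (u j : ℂ) • P.L j

/-- `ρ` is the (Carathéodory) solution on `[ti, T]` of `dρ/dt = L(u(t)) ρ`, `ρ(ti) = ρ₀`, for the
integrable control functions `u`; the equation is written in integrated form, entry by entry. -/
def IsTrajectory (u : ℝ → Fin m → ℝ) (T : ℝ) (ρ : ℝ → Op N) : Prop :=
  (∀ j, IntervalIntegrable (fun t => u t j) volume P.ti T) ∧
  ContinuousOn ρ (Set.Icc P.ti T) ∧
  ∀ t ∈ Set.Icc P.ti T, ∀ a b,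
    ρ t a b = P.ρ₀ a b + ∫ s in P.ti..t, (P.liouvillian (u s) (ρ s)) a b

/-- Admissible processes: final time, controls within their bounds, and the state trajectory. -/
def IsAdmissible (u : ℝ → Fin m → ℝ) (T : ℝ) (ρ : ℝ → Op N) : Prop :=
  P.ti ≤ T ∧ (∀ t, P.tf = some t → T = t) ∧
  (∀ t ∈ Set.Icc P.ti T, ∀ j, u t j ∈ Set.Icc (P.umin j) (P.umax j)) ∧
  P.IsTrajectory u T ρ

/-- The performance index `J = Tr[O ρ(T)]`. -/
def performance (T : ℝ) (ρ : ℝ → Op N) : ℝ :=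
  (P.O * ρ T).trace.re

/-- Solutions of the terminal control problem. -/
def IsOptimal (u : ℝ → Fin m → ℝ) (T : ℝ) (ρ : ℝ → Op N) : Prop :=
  P.IsAdmissible u T ρ ∧
  ∀ u' T' ρ', P.IsAdmissible u' T' ρ' → P.performance T' ρ' ≤ P.performance T ρ

/-- Pontryagin's function `K(ρ, u, ψ) = Tr[ψ L(u) ρ]`. -/
def pontryagin (ρ : Op N) (u : Fin m → ℝ) (ψ : Op N) : ℂ :=
  (ψ * P.liouvillian u ρ).trace

/-- The costate `ψ` of the process `(u, T, ρ)`. It satisfies `dψ/dt = -∂K/∂ρ` on `[ti, T]` and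
the transversality condition `ψ(T) = O - J`. As `K` is linear in `ρ`, the component of the costate
equation along `X` is `d/dt Tr[ψ(t) X] = -K(X, u(t), ψ(t))`; it is written in integrated form. -/
def IsCostate (u : ℝ → Fin m → ℝ) (T : ℝ) (ρ ψ : ℝ → Op N) : Prop :=
  ContinuousOn ψ (Set.Icc P.ti T) ∧
  ψ T = P.O - (P.performance T ρ : ℂ) • (1 : Op N) ∧
  ∀ t ∈ Set.Icc P.ti T, ∀ X : Op N,
    (ψ t * X).trace = (ψ T * X).trace + ∫ s in t..T, P.pontryagin X (u s) (ψ s)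

/-- The switching function `∂K/∂u_k = Tr[ψ L_k ρ]`. -/
def switching (k : Fin m) (ρ ψ : Op N) : ℂ :=
  (ψ * P.L k ρ).trace

/-- The switching function is the derivative of Pontryagin's function in `u_k`. -/
theorem hasDerivAt_pontryagin (k : Fin m) (ρ ψ : Op N) (u : Fin m → ℝ) (x : ℝ) :
    HasDerivAt (fun y : ℝ => P.pontryagin ρ (Function.update u k y) ψ)
      (P.switching k ρ ψ) x := by
  have h : (fun y : ℝ => P.pontryagin ρ (Function.update u k y) ψ) =
      fun y : ℝ => P.pontryagin ρ (Function.update u k 0) ψ + (y : ℂ) * P.switching k ρ ψ := by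
    funext y
    simp only [pontryagin, switching, liouvillian, LinearMap.add_apply, LinearMap.sum_apply,
      LinearMap.smul_apply, mul_add, Matrix.trace_add, Matrix.mul_sum, Matrix.trace_sum,
      Matrix.mul_smul, Matrix.trace_smul, smul_eq_mul, add_assoc]
    congr 1
    rw [← Finset.add_sum_erase _ _ (Finset.mem_univ k),
      ← Finset.add_sum_erase _ (fun j => ((Function.update u k (0 : ℝ) j : ℝ) : ℂ) *
        (ψ * P.L j ρ).trace) (Finset.mem_univ k)]
    have e : ∀ z : ℝ, ∑ j ∈ Finset.univ.erase k, ((Function.update u k z j : ℝ) : ℂ) *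
        (ψ * P.L j ρ).trace = ∑ j ∈ Finset.univ.erase k, (u j : ℂ) * (ψ * P.L j ρ).trace := by
      intro z
      refine Finset.sum_congr rfl fun j hj => ?_
      rw [Function.update_of_ne (Finset.ne_of_mem_erase hj)]
    simp only [e, Function.update_self]
    push_cast
    ring
  rw [h]
  simpa using ((Complex.ofRealCLM.hasDerivAt (x := x)).mul_const
    (P.switching k ρ ψ)).const_add (P.pontryagin ρ (Function.update u k 0) ψ)

/-- `(t₁, t₂)` is a singular subarc of the `k`-th control of the process `(u, T, ρ)`: the switching
function vanishes identically on this nonempty interval. -/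
def IsSingularSubarc (k : Fin m) (u : ℝ → Fin m → ℝ) (T : ℝ) (ρ : ℝ → Op N) (t₁ t₂ : ℝ) : Prop :=
  P.ti ≤ t₁ ∧ t₁ < t₂ ∧ t₂ ≤ T ∧
  ∃ ψ : ℝ → Op N, P.IsCostate u T ρ ψ ∧
    ∀ t ∈ Set.Ioo t₁ t₂, P.switching k (ρ t) (ψ t) = 0

/-- On `[ti, T]`, `v` differs from `u` only in the `k`-th control, and only inside `(t₁, t₂)`. -/
def IsVariation (k : Fin m) (u v : ℝ → Fin m → ℝ) (T t₁ t₂ : ℝ) : Prop :=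
  ∀ t ∈ Set.Icc P.ti T, ∀ j, (j ≠ k ∨ t ∉ Set.Ioo t₁ t₂) → v t j = u t j

/-- The `k`-th control is redundant on `(t₁, t₂)`: every variation of it there, within the bounds
or not, leaves the performance index unchanged. -/
def IsRedundant (k : Fin m) (u : ℝ → Fin m → ℝ) (T : ℝ) (ρ : ℝ → Op N) (t₁ t₂ : ℝ) : Prop :=
  ∀ v ρ', P.IsVariation k u v T t₁ t₂ → P.IsTrajectory v T ρ' →
    P.performance T ρ' = P.performance T ρ

/-- The `k`-th control is unspecified on `(t₁, t₂)`: every variation of it there within the bounds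
is again a solution of the terminal control problem. -/
def IsUnspecified (k : Fin m) (u : ℝ → Fin m → ℝ) (T t₁ t₂ : ℝ) : Prop :=
  ∀ v ρ', P.IsVariation k u v T t₁ t₂ → P.IsAdmissible v T ρ' → P.IsOptimal v T ρ'

end TerminalControlProblem

/-! Compare the given trajectory `ρ` with the trajectory `ρ'` of a variation `v` of `u_k` through
`g(t) = Tr[ψ(t) (ρ'(t) - ρ(t))]`. The costate equation cancels the common part of the two
generators, so `g' = (v_k - u_k) Tr[ψ L_k ρ']`. On a singular subarc `Tr[ψ L_k ρ] = 0`, hence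
`g' = (v_k - u_k) Tr[ψ L_k (ρ' - ρ)]`; as `ρ' - ρ` is traceless and `L_k` acts on traceless
operators as a scalar `γ`, namely `-1` for relaxation to `ρ_k`, `g' = (v_k - u_k) γ g`.
Since `g(ti) = 0`, `g` vanishes identically, and `g(T) = Tr[O (ρ'(T) - ρ(T))]` is the change
of the performance index. -/

theorem absolutelyContinuousOnInterval_of_dist_le {X Y : Type*} [PseudoMetricSpace X]
    [PseudoMetricSpace Y] {f : ℝ → X} {g : ℝ → Y} {a b : ℝ}
    (hg : AbsolutelyContinuousOnInterval g a b) (C : ℝ)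
    (h : ∀ x ∈ Set.uIcc a b, ∀ y ∈ Set.uIcc a b, dist (f x) (f y) ≤ C * dist (g x) (g y)) :
    AbsolutelyContinuousOnInterval f a b := by
  refine squeeze_zero' (.of_forall fun _ => Finset.sum_nonneg fun _ _ => dist_nonneg) ?_
    (by simpa only [mul_zero] using Filter.Tendsto.const_mul C hg)
  refine Filter.eventually_inf_principal.2 (.of_forall fun I hI => ?_)
  rw [Finset.mul_sum]
  exact Finset.sum_le_sum fun i hi => h _ (hI.1 i hi).1 _ (hI.1 i hi).2

theorem absolutelyContinuousOnInterval_contDiff_comp {E F : Type*} [NormedAddCommGroup E]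
    [NormedSpace ℝ E] [ProperSpace E] [NormedAddCommGroup F] [NormedSpace ℝ F] {h : E → F}
    (hh : ContDiff ℝ 1 h) {f : ℝ → E} {a b : ℝ} (hf : AbsolutelyContinuousOnInterval f a b) :
    AbsolutelyContinuousOnInterval (fun t => h (f t)) a b := by
  obtain ⟨C, hC⟩ := hf.exists_bound
  obtain ⟨K, hK⟩ := hh.contDiffOn.exists_lipschitzOnWith one_ne_zero
    (convex_closedBall (0 : E) C) (isCompact_closedBall 0 C)
  exact absolutelyContinuousOnInterval_of_dist_le hf K fun x hx y hy =>
    hK.dist_le_mul _ (mem_closedBall_zero_iff.2 (hC x hx)) _ (mem_closedBall_zero_iff.2 (hC y hy))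

/-- `F` is a Carathéodory primitive of `f` on the interval with endpoints `a` and `b`: it is
absolutely continuous there, with derivative `f` almost everywhere. -/
structure IsPrimitiveOn {E : Type*} [NormedAddCommGroup E] [NormedSpace ℝ E]
    (F f : ℝ → E) (a b : ℝ) : Prop where
  absolutelyContinuous : AbsolutelyContinuousOnInterval F a b
  ae_hasDerivAt : ∀ᵐ x, x ∈ Set.uIcc a b → HasDerivAt F (f x) x

namespace IsPrimitiveOn

section NormedSpace

variable {E : Type*} [NormedAddCommGroup E] [NormedSpace ℝ E] {F G f g : ℝ → E} {a b : ℝ}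

theorem congr_deriv (hF : IsPrimitiveOn F f a b) (h : ∀ x ∈ Set.uIcc a b, f x = g x) :
    IsPrimitiveOn F g a b :=
  ⟨hF.1, hF.2.mono fun x hx hxm => h x hxm ▸ hx hxm⟩

theorem of_eq_add_integral [CompleteSpace E] (hf : IntervalIntegrable f volume a b) {c : ℝ}
    (hc : c ∈ Set.uIcc a b) (F₀ : E)
    (h : ∀ t ∈ Set.uIcc a b, F t = F₀ + ∫ s in c..t, f s) : IsPrimitiveOn F f a b where
  absolutelyContinuous := by
    have hsub : ∀ x ∈ Set.uIcc a b, IntervalIntegrable f volume c x := fun x hx =>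
      hf.mono_set (Set.uIcc_subset_uIcc hc hx)
    refine absolutelyContinuousOnInterval_of_dist_le
      (hf.norm.absolutelyContinuousOnInterval_intervalIntegral hc) 1 fun x hx y hy => ?_
    rw [h x hx, h y hy, dist_add_left, dist_eq_norm, Real.dist_eq,
      intervalIntegral.integral_interval_sub_left (hsub x hx) (hsub y hy),
      intervalIntegral.integral_interval_sub_left (hsub x hx).norm (hsub y hy).norm, one_mul]
    exact intervalIntegral.norm_integral_le_abs_integral_norm
  ae_hasDerivAt := by
    filter_upwards [hf.ae_hasDerivAt_integral, Measure.ae_ne volume (min a b),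
      Measure.ae_ne volume (max a b)] with x hx hmin hmax hxm
    have hnhds : Set.uIcc a b ∈ nhds x :=
      Icc_mem_nhds (hxm.1.lt_of_ne hmin.symm) (hxm.2.lt_of_ne hmax)
    exact ((hx hxm c hc).const_add F₀).congr_of_eventuallyEq (Filter.mem_of_superset hnhds h)

theorem sub (hF : IsPrimitiveOn F f a b) (hG : IsPrimitiveOn G g a b) :
    IsPrimitiveOn (fun t => F t - G t) (fun t => f t - g t) a b where
  absolutelyContinuous := hF.1.fun_sub hG.1
  ae_hasDerivAt := by
    filter_upwards [hF.2, hG.2] with x hx hy hxm using (hx hxm).fun_sub (hy hxm)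

theorem sum {ι : Type*} (s : Finset ι) {F f : ι → ℝ → E}
    (h : ∀ i ∈ s, IsPrimitiveOn (F i) (f i) a b) :
    IsPrimitiveOn (fun t => ∑ i ∈ s, F i t) (fun t => ∑ i ∈ s, f i t) a b where
  absolutelyContinuous := by
    rw [← Finset.sum_fn]
    exact Finset.sum_induction F (AbsolutelyContinuousOnInterval · a b) (fun _ _ => .add)
      contDiffOn_const.absolutelyContinuousOnInterval fun i hi => (h i hi).1
  ae_hasDerivAt := by
    filter_upwards [(Finset.eventually_all s).2 fun i hi => (h i hi).2] with x hx hxm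
    exact HasDerivAt.fun_sum fun i hi => hx i hi hxm

theorem smul {𝕜 : Type*} [NormedField 𝕜] [NormedAlgebra ℝ 𝕜] [NormedSpace 𝕜 E]
    [IsScalarTower ℝ 𝕜 E] {W w : ℝ → 𝕜} (hW : IsPrimitiveOn W w a b)
    (hF : IsPrimitiveOn F f a b) :
    IsPrimitiveOn (fun t => W t • F t) (fun t => W t • f t + w t • F t) a b where
  absolutelyContinuous := hW.1.fun_smul hF.1
  ae_hasDerivAt := by
    filter_upwards [hW.2, hF.2] with x hx hy hxm using (hx hxm).fun_smul (hy hxm)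

theorem eq_of_deriv_eq_zero (hF : IsPrimitiveOn F f a b) (h : ∀ x ∈ Set.uIcc a b, f x = 0)
    {x y : ℝ} (hx : x ∈ Set.uIcc a b) (hy : y ∈ Set.uIcc a b) : F x = F y := by
  obtain ⟨C, hC⟩ := hF.1.const_of_ae_hasDerivAt_zero (hF.congr_deriv h).2
  rw [hC x hx, hC y hy]

end NormedSpace

theorem cexp {W w : ℝ → ℂ} {a b : ℝ} (hW : IsPrimitiveOn W w a b) :
    IsPrimitiveOn (fun t => Complex.exp (W t)) (fun t => Complex.exp (W t) * w t) a b where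
  absolutelyContinuous := absolutelyContinuousOnInterval_contDiff_comp Complex.contDiff_exp hW.1
  ae_hasDerivAt := hW.2.mono fun _ hx hxm => (hx hxm).cexp

theorem eq_zero_of_linear {E : Type*} [NormedAddCommGroup E] [NormedSpace ℂ E] {F : ℝ → E}
    {w : ℝ → ℂ} {a b : ℝ} (hw : IntervalIntegrable w volume a b)
    (hF : IsPrimitiveOn F (fun t => w t • F t) a b) {x₀ : ℝ} (hx₀ : x₀ ∈ Set.uIcc a b)
    (h₀ : F x₀ = 0) {x : ℝ} (hx : x ∈ Set.uIcc a b) : F x = 0 := by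
  -- The integrating factor `exp (-∫ w)` makes the product with `F` constant.
  have hW : IsPrimitiveOn (fun t => ∫ s in a..t, -w s) (fun t => -w t) a b :=
    of_eq_add_integral hw.neg Set.left_mem_uIcc 0 fun _ _ => (zero_add _).symm
  have hconst := (hW.cexp.smul hF).eq_of_deriv_eq_zero
    (fun t _ => by rw [smul_smul, ← add_smul, mul_neg, add_neg_cancel, zero_smul]) hx hx₀
  rw [h₀, smul_zero] at hconst
  exact (smul_eq_zero.1 hconst).resolve_left (Complex.exp_ne_zero _)

end IsPrimitiveOn

theorem intervalIntegrable_add_sum_smul {ι E : Type*} [Fintype ι] [NormedAddCommGroup E]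
    [NormedSpace ℝ E] {w : ι → ℝ → ℝ} {f₀ : ℝ → E} {f : ι → ℝ → E} {a b : ℝ}
    (hw : ∀ j, IntervalIntegrable (w j) volume a b) (hf₀ : ContinuousOn f₀ (Set.uIcc a b))
    (hf : ∀ j, ContinuousOn (f j) (Set.uIcc a b)) :
    IntervalIntegrable (fun t => f₀ t + ∑ j, w j t • f j t) volume a b := by
  refine hf₀.intervalIntegrable.add ?_
  rw [← Finset.sum_fn]
  exact .sum Finset.univ fun j _ => (hw j).smul_continuousOn (hf j)

theorem sum_sum_smul_map_single {m n R V : Type*} [Fintype m] [Fintype n] [DecidableEq m]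
    [DecidableEq n] [CommSemiring R] [AddCommMonoid V] [Module R V]
    (φ : Matrix m n R →ₗ[R] V) (A : Matrix m n R) :
    ∑ i, ∑ j, A i j • φ (Matrix.single i j 1) = φ A := by
  conv_rhs => rw [Matrix.matrix_eq_sum_single A]
  simp only [map_sum, ← map_smul, Matrix.smul_single, smul_eq_mul, mul_one]

open scoped MatrixOrder Matrix.Norms.L2Operator in
theorem span_isDensityMatrix (N : ℕ) :
    Submodule.span ℂ {σ : Op N | IsDensityMatrix σ} = ⊤ := by
  rw [eq_top_iff, ← CStarAlgebra.span_nonneg (A := Op N), Submodule.span_le]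
  intro A hA
  have hA : A.PosSemidef := Matrix.nonneg_iff_posSemidef.1 hA
  by_cases htr : A.trace = 0
  · rw [hA.trace_eq_zero_iff.1 htr]
    exact zero_mem _
  · have hdens : IsDensityMatrix (A.trace⁻¹ • A) :=
      ⟨hA.smul (inv_nonneg.2 hA.trace_nonneg), by
        rw [Matrix.trace_smul, smul_eq_mul, inv_mul_cancel₀ htr]⟩
    rw [← smul_inv_smul₀ htr A]
    exact Submodule.smul_mem _ _ (Submodule.subset_span hdens)

theorem apply_eq_neg_add_trace_smul_of_isDensityMatrix {N : ℕ} {M : Superop N} {ρk : Op N}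
    (h : ∀ σ : Op N, IsDensityMatrix σ → M σ = -σ + ρk) (X : Op N) :
    M X = -X + X.trace • ρk := by
  have hM : M = -LinearMap.id + (Matrix.traceLinearMap (Fin N) ℂ ℂ).smulRight ρk :=
    LinearMap.ext_on (span_isDensityMatrix N) fun σ hσ => by simp [h σ hσ, hσ.2]
  rw [hM]
  rfl

namespace TerminalControlProblem

variable {N m : ℕ} (P : TerminalControlProblem N m)

theorem pontryagin_eq_add_sum_switching (X ψ : Op N) (u : Fin m → ℝ) :
    P.pontryagin X u ψ = (ψ * P.L₀ X).trace + ∑ j, u j • P.switching j X ψ := by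
  simp [pontryagin, switching, liouvillian, mul_add, Matrix.mul_sum, Matrix.trace_sum]

theorem pontryagin_sub_pontryagin {k : Fin m} {u v : Fin m → ℝ} (h : ∀ j, j ≠ k → v j = u j)
    (X ψ : Op N) :
    P.pontryagin X v ψ - P.pontryagin X u ψ = (v k - u k) • P.switching k X ψ := by
  rw [pontryagin_eq_add_sum_switching, pontryagin_eq_add_sum_switching, add_sub_add_left_eq_sub,
    ← Finset.sum_sub_distrib, sub_smul]
  exact Fintype.sum_eq_single k fun j hj => by rw [h j hj, sub_self]

theorem switching_sub (k : Fin m) (X Y ψ : Op N) :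
    P.switching k (X - Y) ψ = P.switching k X ψ - P.switching k Y ψ := by
  simp only [switching, map_sub, mul_sub, Matrix.trace_sub]

theorem intervalIntegrable_pontryagin {u : ℝ → Fin m → ℝ} {X ψ : ℝ → Op N} {a b : ℝ}
    (hu : ∀ j, IntervalIntegrable (fun t => u t j) volume a b)
    (hX : ContinuousOn X (Set.uIcc a b)) (hψ : ContinuousOn ψ (Set.uIcc a b)) :
    IntervalIntegrable (fun t => P.pontryagin (X t) (u t) (ψ t)) volume a b := by
  have hcont (M : Superop N) : ContinuousOn (fun t => (ψ t * M (X t)).trace) (Set.uIcc a b) :=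
    continuous_id.matrix_trace.comp_continuousOn
      (hψ.mul (M.continuous_of_finiteDimensional.comp_continuousOn hX))
  simp only [pontryagin_eq_add_sum_switching]
  exact intervalIntegrable_add_sum_smul hu (hcont P.L₀) fun j => hcont (P.L j)

/-- `φ` solves on `[ti, T]` the costate equation `dφ/dt = -∂K/∂ρ` for the controls `u`, with no
condition on `φ(T)`. The equation is integrated as in `IsCostate`. Besides costates, the constant
`1` is a solution whenever the evolution preserves the trace. -/
def SolvesCostateEquation (u : ℝ → Fin m → ℝ) (T : ℝ) (φ : ℝ → Op N) : Prop :=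
  ContinuousOn φ (Set.Icc P.ti T) ∧
  ∀ t ∈ Set.Icc P.ti T, ∀ X : Op N,
    (φ t * X).trace = (φ T * X).trace + ∫ s in t..T, P.pontryagin X (u s) (φ s)

variable {P} {k : Fin m} {u v : ℝ → Fin m → ℝ} {T t₁ t₂ : ℝ} {ρ ρ' ψ φ : ℝ → Op N}

theorem IsCostate.solvesCostateEquation (h : P.IsCostate u T ρ ψ) :
    P.SolvesCostateEquation u T ψ :=
  ⟨h.1, h.2.2⟩

theorem solvesCostateEquation_one
    (h : ∀ t ∈ Set.Icc P.ti T, ∀ X, (P.liouvillian (u t) X).trace = 0) :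
    P.SolvesCostateEquation u T fun _ => 1 := by
  refine ⟨continuousOn_const, fun t ht X => ?_⟩
  have hzero : Set.EqOn (fun s => P.pontryagin X (u s) 1) 0 (Set.uIcc t T) := by
    rw [Set.uIcc_of_le ht.2]
    exact fun s hs => by simpa [pontryagin] using h s ⟨ht.1.trans hs.1, hs.2⟩ X
  rw [intervalIntegral.integral_congr hzero]
  simp

theorem IsTrajectory.apply_initial (hT : P.ti ≤ T) (h : P.IsTrajectory v T ρ) :
    ρ P.ti = P.ρ₀ := by
  ext a b
  simpa using h.2.2 P.ti (Set.left_mem_Icc.2 hT) a b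

theorem IsTrajectory.isPrimitiveOn_entry (hT : P.ti ≤ T) (h : P.IsTrajectory v T ρ)
    (a b : Fin N) :
    IsPrimitiveOn (fun t => ρ t a b) (fun t => P.liouvillian (v t) (ρ t) a b) P.ti T := by
  obtain ⟨hv, hρ, heq⟩ := h
  rw [← Set.uIcc_of_le hT] at hρ heq
  refine .of_eq_add_integral ?_ Set.left_mem_uIcc (P.ρ₀ a b) fun t ht => heq t ht a b
  simpa [pontryagin, Matrix.trace_single_mul] using
    P.intervalIntegrable_pontryagin hv hρ (continuousOn_const (c := Matrix.single b a 1))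

theorem SolvesCostateEquation.isPrimitiveOn_trace_mul_const (hT : P.ti ≤ T)
    (hu : ∀ j, IntervalIntegrable (fun t => u t j) volume P.ti T)
    (h : P.SolvesCostateEquation u T φ) (X : Op N) :
    IsPrimitiveOn (fun t => (φ t * X).trace) (fun t => -P.pontryagin X (u t) (φ t)) P.ti T := by
  obtain ⟨hφ, heq⟩ := h
  rw [← Set.uIcc_of_le hT] at hφ heq
  refine .of_eq_add_integral (P.intervalIntegrable_pontryagin hu continuousOn_const hφ).neg
    Set.right_mem_uIcc (φ T * X).trace fun t ht => ?_
  rw [intervalIntegral.integral_neg, ← intervalIntegral.integral_symm]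
  exact heq t ht X

theorem SolvesCostateEquation.isPrimitiveOn_trace_mul (hT : P.ti ≤ T)
    (hu : ∀ j, IntervalIntegrable (fun t => u t j) volume P.ti T)
    (hφ : P.SolvesCostateEquation u T φ) (hρ : P.IsTrajectory v T ρ) :
    IsPrimitiveOn (fun t => (φ t * ρ t).trace)
      (fun t => P.pontryagin (ρ t) (v t) (φ t) - P.pontryagin (ρ t) (u t) (φ t)) P.ti T := by
  let pairing (t : ℝ) : Op N →ₗ[ℂ] ℂ :=
    Matrix.traceLinearMap (Fin N) ℂ ℂ ∘ₗ LinearMap.mulLeft ℂ (φ t)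
  have hexpand (t : ℝ) (X : Op N) :
      ∑ a, ∑ b, X a b • (φ t * Matrix.single a b 1).trace = (φ t * X).trace :=
    sum_sum_smul_map_single (pairing t) X
  have hexpand' (t : ℝ) : ∑ a, ∑ b, ρ t a b • P.pontryagin (Matrix.single a b 1) (u t) (φ t) =
      P.pontryagin (ρ t) (u t) (φ t) :=
    sum_sum_smul_map_single (pairing t ∘ₗ P.liouvillian (u t)) (ρ t)
  have hsum := IsPrimitiveOn.sum Finset.univ fun a _ => IsPrimitiveOn.sum Finset.univ fun b _ =>
    (hρ.isPrimitiveOn_entry hT a b).smul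
      (hφ.isPrimitiveOn_trace_mul_const hT hu (Matrix.single a b 1))
  simp only [smul_neg, Finset.sum_add_distrib, Finset.sum_neg_distrib, hexpand, hexpand'] at hsum
  exact hsum.congr_deriv fun t _ => neg_add_eq_sub _ _

theorem SolvesCostateEquation.isPrimitiveOn_trace_mul_sub (hT : P.ti ≤ T)
    (hφ : P.SolvesCostateEquation u T φ) (hρ : P.IsTrajectory u T ρ)
    (hρ' : P.IsTrajectory v T ρ') (hv : P.IsVariation k u v T t₁ t₂) :
    IsPrimitiveOn (fun t => (φ t * (ρ' t - ρ t)).trace)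
      (fun t => (v t k - u t k) • P.switching k (ρ' t) (φ t)) P.ti T := by
  simp only [mul_sub, Matrix.trace_sub]
  refine ((hφ.isPrimitiveOn_trace_mul hT hρ.1 hρ').sub
    (hφ.isPrimitiveOn_trace_mul hT hρ.1 hρ)).congr_deriv fun t ht => ?_
  rw [Set.uIcc_of_le hT] at ht
  rw [sub_self, sub_zero, P.pontryagin_sub_pontryagin fun j hj => hv t ht j (.inl hj)]

theorem IsVariation.trace_sub_eq_zero (hv : P.IsVariation k u v T t₁ t₂)
    (hLk : ∀ X, (P.L k X).trace = 0) (hadm : P.IsAdmissible u T ρ)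
    (hρ' : P.IsTrajectory v T ρ') {t : ℝ} (ht : t ∈ Set.uIcc P.ti T) :
    (ρ' t - ρ t).trace = 0 := by
  obtain ⟨hT, -, hbd, hρ⟩ := hadm
  have hone : P.SolvesCostateEquation u T fun _ => 1 :=
    solvesCostateEquation_one fun s hs => (P.isLiouvillian (u s) (hbd s hs)).1
  have hconst := (hone.isPrimitiveOn_trace_mul_sub hT hρ hρ' hv).eq_of_deriv_eq_zero
    (fun s _ => by rw [switching, one_mul, hLk, smul_zero]) ht Set.left_mem_uIcc
  simpa [hρ.apply_initial hT, hρ'.apply_initial hT] using hconst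

theorem IsCostate.re_trace_mul_sub_final (h : P.IsCostate u T ρ ψ)
    (htr : (ρ' T - ρ T).trace = 0) :
    (ψ T * (ρ' T - ρ T)).trace.re = P.performance T ρ' - P.performance T ρ := by
  rw [h.2.1, sub_mul, Matrix.trace_sub, smul_mul_assoc, one_mul, Matrix.trace_smul, htr,
    smul_zero, sub_zero, mul_sub, Matrix.trace_sub, Complex.sub_re]
  rfl

theorem switching_eq_mul_trace_of_switching_eq_zero {γ : ℂ} {σ σ' χ : Op N}
    (hLk : ∀ X, X.trace = 0 → P.L k X = γ • X) (htr : (σ' - σ).trace = 0)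
    (hσ : P.switching k σ χ = 0) :
    P.switching k σ' χ = γ * (χ * (σ' - σ)).trace := by
  rw [← sub_zero (P.switching k σ' χ), ← hσ, ← P.switching_sub, switching, hLk _ htr,
    Matrix.mul_smul, Matrix.trace_smul, smul_eq_mul]

theorem IsOptimal.isUnspecified_of_isRedundant (hopt : P.IsOptimal u T ρ)
    (h : P.IsRedundant k u T ρ t₁ t₂) : P.IsUnspecified k u T t₁ t₂ :=
  fun v ρ' hv hadm => ⟨hadm, fun u' T' σ hσ =>
    (hopt.2 u' T' σ hσ).trans_eq (h v ρ' hv hadm.2.2.2).symm⟩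

end TerminalControlProblem

theorem theorem4_general {N m : ℕ} (P : TerminalControlProblem N m) (k : Fin m) (γ : ℂ)
    (htr : ∀ X : Op N, (P.L k X).trace = 0)
    (hLk : ∀ X : Op N, X.trace = 0 → P.L k X = γ • X)
    (u : ℝ → Fin m → ℝ) (T : ℝ) (ρ : ℝ → Op N) (hadm : P.IsAdmissible u T ρ)
    (t₁ t₂ : ℝ) (hsing : P.IsSingularSubarc k u T ρ t₁ t₂) :
    P.IsRedundant k u T ρ t₁ t₂ := by
  intro v ρ' hv hρ'
  obtain ⟨-, -, -, ψ, hψ, hsw⟩ := hsing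
  have htrace : ∀ t ∈ Set.uIcc P.ti T, (ρ' t - ρ t).trace = 0 := fun t =>
    hv.trace_sub_eq_zero htr hadm hρ'
  obtain ⟨hT, -, -, hρ⟩ := hadm
  have hlinear : IsPrimitiveOn (fun t => (ψ t * (ρ' t - ρ t)).trace)
      (fun t => ((v t k - u t k) • γ) • (ψ t * (ρ' t - ρ t)).trace) P.ti T := by
    refine (hψ.solvesCostateEquation.isPrimitiveOn_trace_mul_sub hT hρ hρ' hv).congr_deriv
      fun t ht => ?_
    by_cases hts : t ∈ Set.Ioo t₁ t₂
    · rw [TerminalControlProblem.switching_eq_mul_trace_of_switching_eq_zero hLk (htrace t ht)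
        (hsw t hts), smul_assoc, smul_eq_mul]
    · simp only [hv t (Set.uIcc_of_le hT ▸ ht) k (.inr hts), sub_self, zero_smul]
  have hrate : IntervalIntegrable (fun t => (v t k - u t k) • γ) volume P.ti T :=
    ((hρ'.1 k).sub (hρ.1 k)).smul_continuousOn continuousOn_const
  have hinitial : (ψ P.ti * (ρ' P.ti - ρ P.ti)).trace = 0 := by
    rw [hρ'.apply_initial hT, hρ.apply_initial hT, sub_self, mul_zero, Matrix.trace_zero]
  have hfinal := hlinear.eq_zero_of_linear hrate Set.left_mem_uIcc hinitial Set.right_mem_uIcc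
  rw [← sub_eq_zero, ← hψ.re_trace_mul_sub_final (htrace T Set.right_mem_uIcc), hfinal,
    Complex.zero_re]

theorem theorem4 {N m : ℕ} (P : TerminalControlProblem N m) (k : Fin m) (ρk : Op N)
    (hρk : IsDensityMatrix ρk)
    (hLk : ∀ σ : Op N, IsDensityMatrix σ → P.L k σ = -σ + ρk)
    (u : ℝ → Fin m → ℝ) (T : ℝ) (ρ : ℝ → Op N) (hopt : P.IsOptimal u T ρ)
    (t₁ t₂ : ℝ) (hsing : P.IsSingularSubarc k u T ρ t₁ t₂) :
    P.IsUnspecified k u T t₁ t₂ ∧ P.IsRedundant k u T ρ t₁ t₂ := by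
  have hL := apply_eq_neg_add_trace_smul_of_isDensityMatrix hLk
  have hred : P.IsRedundant k u T ρ t₁ t₂ :=
    theorem4_general P k (-1) (by simp [hL, hρk.2]) (by simp +contextual [hL]) u T ρ hopt.1
      t₁ t₂ hsing
  exact ⟨hopt.isUnspecified_of_isRedundant hred, hred⟩
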